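/- Equip the Heisenberg group $H_1=\mathbb{R}^3$ with the left invariant fields $\mathring e_1=\partial_x+y\,\partial_z$, $\mathring e_2=\partial_y-x\,\partial_z$, $T=\partial_z$, the contact form $\Theta=dz+x\,dy-y\,dx$, the contact bundle $\xi=\ker\Theta$, the CR structure $J$ on $\xi$ with $J\mathring e_1=\mathring e_2$ and $J\mathring e_2=-\mathring e_1$, the adapted metric for which $\mathring e_1,\mathring e_2,T$ are orthonormal, and the connection $\nabla$ for which $\mathring e_1,\mathring e_2,T$ are parallel. A Heisenberg rigid motion is a diffeomorphism of $H_1$ preserving $\Theta$ and $J$. For a surface $\Sigma\subset H_1$ without singular points (that is, $T_q\Sigma\neq\xi_q$ for all $q\in\Sigma$) and a unit vector field $e_1\in T\Sigma\cap\xi$, put $e_2=Je_1$; the $p$-mean curvature $H$ is defined by $\nabla_{e_1}e_2=-He_1$, the $\alpha$-function $\alpha$ by $\alpha e_2+T\in T\Sigma$, and $\hat e_1=e_1$, $\hat e_2=(\alpha e_2+T)/\sqrt{1+\alpha^2}$. Let $\alpha$ and $H$ be smooth functions on an open set $U\subset\mathbb{R}^2$ with coordinates $(x,y)$. Let $A$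 and $B$ be smooth functions on $U$ with $A_x=2\alpha$ and $B_x=H\alpha e^{A}$ (anti-derivatives $A=\int 2\alpha\,dx$ and $B=\int H\alpha\,e^{\int 2\alpha dx}\,dx$ with respect to $x$), and let $h(y)$, $k(y)$ be smooth functions of $y$ on the projection of $U$ to the $y$-axis. Suppose that on $U$ the integrability condition $$\bigl(h(y)-B\bigr)H_x+e^{k(y)}H_y=e^{A}\bigl(\alpha_{xx}+6\alpha\alpha_x+4\alpha^3+\alpha H^2\bigr)$$ holds, and put $$a=\frac{e^{-A}}{\sqrt{1+\alpha^2}}\,\bigl(h(y)-B\bigr),\qquad b=\frac{e^{k(y)}e^{-A}}{\sqrt{1+\alpha^2}}.$$ Then: 1. every point of $U$ has a connected open neighborhood $V\subset U$ and a smooth embedding $X:V\to H_1$ such that the surface $\Sigma=X(V)$ has no singular points and, when $V$ is identified with $\Sigma$ through $X$ and $e_1=\partial/\partial x$ is taken as the characteristic direction (so that $\partial/\partial x$ is a unit vector field in $T\Sigma\cap\xi$), the $p$-mean curvature of $\Sigma$ is $H$, its $\alpha$-function is $\alpha$, and $\hat e_1=\frac{\partial}{\partial x}$, $\hat e_2=a\frac{\partial}{\partial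 x}+b\frac{\partial}{\partial y}$; 2. such embeddings are unique up to a Heisenberg rigid motion: if $V\subset U$ is open and connected and $X,Y:V\to H_1$ are two embeddings as in 1, then $Y=\Phi\circ X$ for some Heisenberg rigid motion $\Phi$. -/

import Mathlib

open scoped ContDiff Manifold

noncomputable section

namespace Heisenberg

/-- The underlying space of the Heisenberg group `H₁`, with coordinates `(x, y, z)`.
Tangent vectors are written in the same coordinates. -/
abbrev H1 : Type := ℝ × ℝ × ℝ

/-- The coordinate plane `ℝ²`, with coordinates `(x, y)`. -/
abbrev Plane : Type := ℝ × ℝ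

/-- The left invariant field `∂/∂x + y ∂/∂z`. -/
def frame1 (q : H1) : H1 := (1, 0, q.2.1)

/-- The left invariant field `∂/∂y - x ∂/∂z`. -/
def frame2 (q : H1) : H1 := (0, 1, -q.1)

/-- The left invariant field `T = ∂/∂z`. -/
def reeb : H1 := (0, 0, 1)

/-- The contact form `Θ = dz + x dy - y dx`. -/
def contactForm (q : H1) : H1 →ₗ[ℝ] ℝ where
  toFun v := v.2.2 + q.1 * v.2.1 - q.2.1 * v.1
  map_add' v w := by simp only [Prod.fst_add, Prod.snd_add]; ring
  map_smul' c v := by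
    simp only [Prod.smul_fst, Prod.smul_snd, smul_eq_mul, RingHom.id_apply]; ring

/-- The components of a tangent vector in the left invariant frame are `dx`, `dy` and `Θ`. -/
theorem frame_decomposition (q v : H1) :
    v = v.1 • frame1 q + v.2.1 • frame2 q + contactForm q v • reeb := by
  obtain ⟨x, y, z⟩ := v
  ext <;> simp [frame1, frame2, reeb, contactForm]
  ring

/-- The contact plane `ξ` at `q`, the kernel of `Θ`. -/
def contactPlane (q : H1) : Submodule ℝ H1 := LinearMap.ker (contactForm q)

/-- The CR structure: `J` sends `frame1` to `frame2` and `frame2` to `-frame1`. It is only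
used on vectors of `ξ` (the formula extends it by `J T = 0`). -/
def J (q v : H1) : H1 := v.1 • frame2 q - v.2.1 • frame1 q

/-- The adapted metric: `frame1`, `frame2`, `reeb` are orthonormal. -/
def adaptedMetric (q v w : H1) : ℝ :=
  v.1 * w.1 + v.2.1 * w.2.1 + contactForm q v * contactForm q w

/-- The covariant derivative, in the direction `v` at `p`, of a vector field `E` along the map
`X`, for the connection on `H₁` whose parallel fields are the left invariant ones: the frame
components of `E` are differentiated. -/
def covDeriv (X E : Plane → H1) (p v : Plane) : H1 :=
  fderiv ℝ (fun s => (E s).1) p v • frame1 (X p)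
    + fderiv ℝ (fun s => (E s).2.1) p v • frame2 (X p)
    + fderiv ℝ (fun s => contactForm (X s) (E s)) p v • reeb

/-- A Heisenberg rigid motion (pseudohermitian transformation): a diffeomorphism of `H₁` which
preserves `Θ` (hence `ξ`) and `J`. -/
structure IsRigidMotion (Φ : H1 ≃ₘ^∞⟮𝓘(ℝ, H1), 𝓘(ℝ, H1)⟯ H1) : Prop where
  contact : ∀ q v : H1, contactForm (Φ q) (fderiv ℝ Φ q v) = contactForm q v
  cr : ∀ q : H1, ∀ v ∈ contactPlane q, fderiv ℝ Φ q (J q v) = J (Φ q) (fderiv ℝ Φ q v)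

/-- `X` is a smooth embedding of the open set `V` into `H₁`. -/
structure IsSmoothEmbeddingOn (X : Plane → H1) (V : Set Plane) : Prop where
  smooth : ContDiffOn ℝ ∞ X V
  immersion : ∀ p ∈ V, Function.Injective (fderiv ℝ X p)
  embedding : Topology.IsEmbedding (V.domRestrict X)

/-- The tangent plane at `X p` of the surface parametrized by `X`. -/
def tangentPlane (X : Plane → H1) (p : Plane) : Submodule ℝ H1 :=
  LinearMap.range (fderiv ℝ X p : Plane →ₗ[ℝ] H1)

/-- The point `X p` is a regular (non-singular) point of the surface. -/
def IsRegularPoint (X : Plane → H1) (p : Plane) : Prop :=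
  tangentPlane X p ≠ contactPlane (X p)

/-- The field `e₁` along the surface whose coordinate expression is `u`. -/
def e1 (X : Plane → H1) (u : Plane → Plane) (p : Plane) : H1 := fderiv ℝ X p (u p)

/-- The field `e₂ = J e₁`. -/
def e2 (X : Plane → H1) (u : Plane → Plane) (p : Plane) : H1 := J (X p) (e1 X u p)

/-- `u` is the coordinate expression of a characteristic direction `e₁`: a smooth unit vector
field with values in `TΣ ∩ ξ`. -/
structure IsCharacteristicDirection (X : Plane → H1) (V : Set Plane) (u : Plane → Plane) :
    Prop where
  smooth : ContDiffOn ℝ ∞ u V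
  horizontal : ∀ p ∈ V, e1 X u p ∈ contactPlane (X p)
  unit : ∀ p ∈ V, adaptedMetric (X p) (e1 X u p) (e1 X u p) = 1

/-- `H` is the `p`-mean curvature (pulled back by `X`): `∇_{e₁} e₂ = -H e₁`. -/
def IsPMeanCurvature (X : Plane → H1) (V : Set Plane) (u : Plane → Plane) (H : Plane → ℝ) :
    Prop :=
  ∀ p ∈ V, covDeriv X (e2 X u) p (u p) = -(H p • e1 X u p)

/-- `α` is the `α`-function (pulled back by `X`): `α e₂ + T` is tangent to the surface. -/
def IsAlphaFunction (X : Plane → H1) (V : Set Plane) (u : Plane → Plane) (α : Plane → ℝ) :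
    Prop :=
  ∀ p ∈ V, α p • e2 X u p + reeb ∈ tangentPlane X p

/-- `w` is the coordinate expression of `ê₂ = (α e₂ + T) / √(1 + α²)`. -/
def IsSecondFrameField (X : Plane → H1) (V : Set Plane) (u : Plane → Plane) (α : Plane → ℝ)
    (w : Plane → Plane) : Prop :=
  ∀ p ∈ V, fderiv ℝ X p (w p) = (√(1 + α p ^ 2))⁻¹ • (α p • e2 X u p + reeb)

/-- `X` embeds `V` as a surface without singular points which, for the characteristic direction
`ê₁ = e₁ = ∂/∂x`, has `p`-mean curvature `H`, `α`-function `α` and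
`ê₂ = a ∂/∂x + b ∂/∂y`. -/
structure IsRealization (X : Plane → H1) (V : Set Plane) (α H a b : Plane → ℝ) : Prop where
  embedding : IsSmoothEmbeddingOn X V
  regular : ∀ p ∈ V, IsRegularPoint X p
  direction : IsCharacteristicDirection X V (fun _ => (1, 0))
  curvature : IsPMeanCurvature X V (fun _ => (1, 0)) H
  alpha : IsAlphaFunction X V (fun _ => (1, 0)) α
  second : IsSecondFrameField X V (fun _ => (1, 0)) α (fun p => (a p, b p))

/-- The partial derivative `∂f/∂x`. -/
def pdx (f : Plane → ℝ) (p : Plane) : ℝ := fderiv ℝ f p (1, 0)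

/-- The partial derivative `∂f/∂y`. -/
def pdy (f : Plane → ℝ) (p : Plane) : ℝ := fderiv ℝ f p (0, 1)

/-- `F` is a smooth anti-derivative of `f` with respect to `x` on `U`. -/
def IsXAntiderivative (F f : Plane → ℝ) (U : Set Plane) : Prop :=
  ContDiffOn ℝ ∞ F U ∧ ∀ p ∈ U, pdx F p = f p

/-- The integrability condition; `A` stands for `∫ 2α dx` and `B` for `∫ Hα e^{∫ 2α dx} dx`. -/
def IntegrabilityCondition (U : Set Plane) (α H A B : Plane → ℝ) (h k : ℝ → ℝ) : Prop :=
  ∀ p ∈ U, (h p.2 - B p) * pdx H p + Real.exp (k p.2) * pdy H p =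
    Real.exp (A p) *
      (pdx (pdx α) p + 6 * α p * pdx α p + 4 * α p ^ 3 + α p * H p ^ 2)

/-- The coefficient `a = e^{-∫ 2α dx} (1 + α²)^{-1/2} (h(y) - ∫ Hα e^{∫ 2α dx} dx)`. -/
def coeffA (α A B : Plane → ℝ) (h : ℝ → ℝ) (p : Plane) : ℝ :=
  Real.exp (-A p) / √(1 + α p ^ 2) * (h p.2 - B p)

/-- The coefficient `b = e^{k(y)} e^{-∫ 2α dx} (1 + α²)^{-1/2}`. -/
def coeffB (α A : Plane → ℝ) (k : ℝ → ℝ) (p : Plane) : ℝ :=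
  Real.exp (k p.2) * (Real.exp (-A p) / √(1 + α p ^ 2))

end Heisenberg

end

namespace Heisenberg

/-! Since `X_x = e₁` is horizontal and of unit length, its frame components are `(cos θ, sin θ)`.
Solving the formula for `ê₂` gives `X_y = P (α e₂ + T) - Q e₁` with `P = e^{A-k}` and `Q = e^{-k}(h
- B)`. Curvature `H` means `θ_x = H`, and equality of the mixed derivatives of `X` forces `θ_y = P
(α_x + 2α²) - Q H`, which is `angularSpeed`. The problem is thus a chain of exact 1-forms: `dθ`,
then `dx` and `dy`, then `dz`. Closedness of `dθ` is the integrability condition; closedness of the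
others follows from `P_x = 2αP` and `Q_x = -HαP`, that is, from the choice of `A` and `B`.

Existence (`IsIntegrableData.exists_solution`) is the Poincaré lemma on a ball, applied four times.
Uniqueness (`SolvesFrameSystem.exists_rigid`) needs only connectedness: for two solutions the fields
`e₁` turn at the same rate, so they differ by a constant rotation, and integrating the remaining
equations produces the three constants of a left translation. `solvesFrameSystem_iff` carries both
results back to surfaces. -/

/-! ### Calculus on open subsets of the plane -/

/-- Smoothness of a coordinate partial derivative. -/
theorem contDiffOn_fderiv_apply {V : Set Plane} (hV : IsOpen V) {f : Plane → ℝ}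
    (hf : ContDiffOn ℝ ∞ f V) (v : Plane) : ContDiffOn ℝ ∞ (fun p => fderiv ℝ f p v) V :=
  (hf.fderiv_of_isOpen hV (by simp)).clm_apply contDiffOn_const

theorem contDiffOn_pdx {V : Set Plane} (hV : IsOpen V) {f : Plane → ℝ}
    (hf : ContDiffOn ℝ ∞ f V) : ContDiffOn ℝ ∞ (pdx f) V :=
  contDiffOn_fderiv_apply hV hf (1, 0)

theorem contDiffOn_pdy {V : Set Plane} (hV : IsOpen V) {f : Plane → ℝ}
    (hf : ContDiffOn ℝ ∞ f V) : ContDiffOn ℝ ∞ (pdy f) V :=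
  contDiffOn_fderiv_apply hV hf (0, 1)

theorem differentiableAt_of_contDiffOn {V : Set Plane} (hV : IsOpen V) {E : Type*}
    [NormedAddCommGroup E] [NormedSpace ℝ E] {f : Plane → E}
    (hf : ContDiffOn ℝ ∞ f V) {p : Plane} (hp : p ∈ V) : DifferentiableAt ℝ f p :=
  (hf.contDiffAt (hV.mem_nhds hp)).differentiableAt (by simp)

theorem fderiv_eq_pdx_pdy (f : Plane → ℝ) (p v : Plane) :
    fderiv ℝ f p v = v.1 * pdx f p + v.2 * pdy f p := by
  have hv : v = v.1 • ((1, 0) : Plane) + v.2 • ((0, 1) : Plane) := by ext <;> simp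
  conv_lhs => rw [hv]
  simp only [map_add, map_smul, smul_eq_mul, pdx, pdy]

theorem pdx_congr {V : Set Plane} (hV : IsOpen V) {f g : Plane → ℝ} (hfg : Set.EqOn f g V)
    {p : Plane} (hp : p ∈ V) : pdx f p = pdx g p := by
  rw [pdx, pdx, (hfg.eventuallyEq_of_mem (hV.mem_nhds hp)).fderiv_eq]

theorem pdx_pdy_comm {V : Set Plane} (hV : IsOpen V) {f : Plane → ℝ}
    (hf : ContDiffOn ℝ ∞ f V) {p : Plane} (hp : p ∈ V) : pdx (pdy f) p = pdy (pdx f) p := by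
  have hs : IsSymmSndFDerivAt ℝ f p :=
    (hf.contDiffAt (hV.mem_nhds hp)).isSymmSndFDerivAt
      (by simpa using WithTop.coe_le_coe.2 (le_top : (2 : ℕ∞) ≤ ⊤))
  have hd : DifferentiableAt ℝ (fderiv ℝ f) p :=
    differentiableAt_of_contDiffOn hV (hf.fderiv_of_isOpen hV (m := ∞) (by simp)) hp
  have key : ∀ v w : Plane,
      fderiv ℝ (fun q => fderiv ℝ f q v) p w = fderiv ℝ (fderiv ℝ f) p w v := by
    intro v w
    rw [(hd.hasFDerivAt.clm_apply (hasFDerivAt_const v p)).fderiv]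
    simp
  change fderiv ℝ (fun q => fderiv ℝ f q (0, 1)) p (1, 0) =
    fderiv ℝ (fun q => fderiv ℝ f q (1, 0)) p (0, 1)
  rw [key, key]
  exact hs.eq _ _

/-- A function whose partial derivatives vanish is constant on a connected open set. -/
theorem exists_eq_const_of_pd_eq_zero {V : Set Plane} (hV : IsOpen V) (hc : IsPreconnected V)
    {f : Plane → ℝ} (hf : ContDiffOn ℝ ∞ f V) (hx : ∀ p ∈ V, pdx f p = 0)
    (hy : ∀ p ∈ V, pdy f p = 0) : ∃ c, ∀ p ∈ V, f p = c := by
  refine hV.exists_is_const_of_fderiv_eq_zero (𝕜 := ℝ) hc (hf.differentiableOn (by simp)) ?_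
  intro p hp
  ext <;> simp [fderiv_eq_pdx_pdy, hx p hp, hy p hp]

/-- Two smooth functions with the same mixed partial derivatives are the partial derivatives of
a smooth function on a convex open set. -/
theorem exists_potential {V : Set Plane} (hV : IsOpen V) (hc : Convex ℝ V) {F G : Plane → ℝ}
    (hF : ContDiffOn ℝ ∞ F V) (hG : ContDiffOn ℝ ∞ G V)
    (h : ∀ p ∈ V, pdy F p = pdx G p) :
    ∃ f : Plane → ℝ, ContDiffOn ℝ ∞ f V ∧ (∀ p ∈ V, pdx f p = F p) ∧ ∀ p ∈ V, pdy f p = G p := by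
  let η : Plane → Plane →L[ℝ] ℝ := fun p =>
    F p • ContinuousLinearMap.fst ℝ ℝ ℝ + G p • ContinuousLinearMap.snd ℝ ℝ ℝ
  have hη : ContDiffOn ℝ ∞ η V := (hF.smul contDiffOn_const).add (hG.smul contDiffOn_const)
  -- Symmetry of the derivative of `η` is closedness of the 1-form `F dx + G dy`, so the Poincaré
  -- lemma applies.
  have hdη : ∀ a ∈ V, ∀ v w, fderiv ℝ η a v w = fderiv ℝ η a w v := by
    intro a ha v w
    have hFa := (differentiableAt_of_contDiffOn hV hF ha).hasFDerivAt
    have hGa := (differentiableAt_of_contDiffOn hV hG ha).hasFDerivAt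
    have hd : HasFDerivAt η _ a := (hFa.smul_const (ContinuousLinearMap.fst ℝ ℝ ℝ)).add
      (hGa.smul_const (ContinuousLinearMap.snd ℝ ℝ ℝ))
    rw [hd.fderiv]
    simp [fderiv_eq_pdx_pdy, h a ha]
    ring
  obtain ⟨f, hf⟩ := hc.exists_forall_hasFDerivAt_of_fderiv_symmetric hV
    (hη.differentiableOn (by simp)) hdη
  refine ⟨f, ?_, fun p hp => ?_, fun p hp => ?_⟩
  · rw [contDiffOn_infty_iff_fderiv_of_isOpen hV]
    exact ⟨fun p hp => (hf p hp).differentiableAt.differentiableWithinAt,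
      hη.congr fun p hp => (hf p hp).fderiv⟩
  · simp [pdx, (hf p hp).fderiv, η]
  · simp [pdy, (hf p hp).fderiv, η]

/-- An immersion at a point restricts to an embedding of a neighborhood. -/
theorem exists_isEmbedding_of_injective_fderiv {E F : Type*} [NormedAddCommGroup E]
    [NormedSpace ℝ E] [FiniteDimensional ℝ E] [NormedAddCommGroup F] [NormedSpace ℝ F]
    {f : E → F} {f' : E →L[ℝ] F} {p : E} (hf : HasStrictFDerivAt f f' p)
    (hinj : Function.Injective f') :
    ∃ s ∈ nhds p, Topology.IsEmbedding (s.domRestrict f) := by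
  -- An injective linear map on a finite-dimensional space expands distances by at least `K⁻¹`. Near
  -- `p` the map `f` differs from it by a `K⁻¹ / 2`-Lipschitz map, which leaves a positive expansion
  -- factor.
  obtain ⟨K, hK, hanti⟩ := (f' : E →ₗ[ℝ] F).exists_antilipschitzWith
    (LinearMap.ker_eq_bot.2 hinj)
  have hK2 : 0 < K⁻¹ / 2 := by positivity
  obtain ⟨s, hs, happ⟩ := hf.approximates_deriv_on_nhds (c := K⁻¹ / 2) (Or.inr hK2)
  refine ⟨s, hs, ?_⟩
  have hlt : K⁻¹ / 2 < K⁻¹ := NNReal.half_lt_self (by positivity)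
  have ha := (AntilipschitzWith.domRestrict hanti s).add_lipschitzWith happ.lipschitz_sub hlt
  have ha' : AntilipschitzWith (K⁻¹ - K⁻¹ / 2)⁻¹ (s.domRestrict f) := by
    convert! ha using 1
    ext x
    simp
  exact (ha'.isUniformEmbedding happ.lipschitz.uniformContinuous).isEmbedding

/-! ### From the geometric conditions to a system for the components -/

theorem fderiv_apply_components {X : Plane → H1} {p : Plane} (hX : DifferentiableAt ℝ X p)
    (v : Plane) : fderiv ℝ X p v = (fderiv ℝ (fun s => (X s).1) p v,
      fderiv ℝ (fun s => (X s).2.1) p v, fderiv ℝ (fun s => (X s).2.2) p v) := by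
  rw [hX.hasFDerivAt.fst.fderiv, hX.hasFDerivAt.snd.fst.fderiv, hX.hasFDerivAt.snd.snd.fderiv]
  rfl

/-- The first order system for the components of a surface with characteristic direction
`∂/∂x`, where `X_y = P (α e₂ + T) - Q e₁`. -/
structure SolvesFrameSystem (x y z : Plane → ℝ) (V : Set Plane) (α H P Q : Plane → ℝ) :
    Prop where
  unit : ∀ p ∈ V, pdx x p ^ 2 + pdx y p ^ 2 = 1
  pdx_z : ∀ p ∈ V, pdx z p = y p * pdx x p - x p * pdx y p
  pdx_pdx_x : ∀ p ∈ V, pdx (pdx x) p = -(H p * pdx y p)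
  pdx_pdx_y : ∀ p ∈ V, pdx (pdx y) p = H p * pdx x p
  pdy_x : ∀ p ∈ V, pdy x p = -(P p * α p * pdx y p) - Q p * pdx x p
  pdy_y : ∀ p ∈ V, pdy y p = P p * α p * pdx x p - Q p * pdx y p
  pdy_z : ∀ p ∈ V, pdy z p = y p * pdy x p - x p * pdy y p + P p

/-- As `J` is a quarter turn, `e₂` has frame components `(-y_x, x_x, 0)`, and the connection
differentiates them. The curvature equation therefore says that the plane vector `(x_x, y_x)` turns
at rate `H`. -/
theorem covDeriv_e2 {X : Plane → H1} {V : Set Plane} (hV : IsOpen V)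
    (hX : ContDiffOn ℝ ∞ X V) {p : Plane} (hp : p ∈ V) :
    covDeriv X (e2 X fun _ => (1, 0)) p (1, 0) =
      -pdx (pdx fun s => (X s).2.1) p • frame1 (X p)
        + pdx (pdx fun s => (X s).1) p • frame2 (X p) := by
  have h1 : Set.EqOn (fun s => (e2 X (fun _ => (1, 0)) s).1)
      (fun s => -pdx (fun s => (X s).2.1) s) V := by
    intro s hs
    simp [e2, e1, J, frame1, frame2, pdx,
      fderiv_apply_components (differentiableAt_of_contDiffOn hV hX hs)]
  have h2 : Set.EqOn (fun s => (e2 X (fun _ => (1, 0)) s).2.1)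
      (pdx (fun s => (X s).1)) V := by
    intro s hs
    simp [e2, e1, J, frame1, frame2, pdx,
      fderiv_apply_components (differentiableAt_of_contDiffOn hV hX hs)]
  have h3 : (fun s => contactForm (X s) (e2 X (fun _ => (1, 0)) s)) = fun _ => 0 := by
    funext s
    simp [e2, J, frame1, frame2, contactForm]
    ring
  have k1 := pdx_congr hV h1 hp
  have k2 := pdx_congr hV h2 hp
  have k3 : pdx (fun s => -pdx (fun s => (X s).2.1) s) p = -pdx (pdx fun s => (X s).2.1) p := by
    rw [pdx, fderiv_fun_neg]
    rfl
  rw [k3] at k1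
  rw [covDeriv, h3]
  change pdx _ p • _ + pdx _ p • _ + _ = _
  rw [k1, k2]
  simp

/-- The geometric conditions, at the level of components. -/
theorem solvesFrameSystem_iff {X : Plane → H1} {V : Set Plane} (hV : IsOpen V)
    (hX : ContDiffOn ℝ ∞ X V) {α H P Q a b : Plane → ℝ} (hP : ∀ p ∈ V, 0 < P p)
    (ha : ∀ p ∈ V, a p = (√(1 + α p ^ 2))⁻¹ * (Q p / P p))
    (hb : ∀ p ∈ V, b p = (√(1 + α p ^ 2))⁻¹ * (1 / P p)) :
    (IsCharacteristicDirection X V (fun _ => (1, 0)) ∧ IsPMeanCurvature X V (fun _ => (1, 0)) H ∧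
      IsSecondFrameField X V (fun _ => (1, 0)) α (fun p => (a p, b p))) ↔
    SolvesFrameSystem (fun s => (X s).1) (fun s => (X s).2.1) (fun s => (X s).2.2) V α H P Q := by
  have hcomp := fun p (hp : p ∈ V) =>
    fderiv_apply_components (differentiableAt_of_contDiffOn hV hX hp)
  have hhor : ∀ p ∈ V, e1 X (fun _ => (1, 0)) p ∈ contactPlane (X p) ↔
      pdx (fun s => (X s).2.2) p = (X p).2.1 * pdx (fun s => (X s).1) p
        - (X p).1 * pdx (fun s => (X s).2.1) p := by
    intro p hp
    rw [contactPlane, LinearMap.mem_ker, e1, hcomp p hp]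
    simp only [contactForm, LinearMap.coe_mk, AddHom.coe_mk, pdx]
    constructor <;> intro h <;> linarith
  -- Because `(a, b)` is `(Q, 1)` divided by `P √(1 + α²)`, the equation for `ê₂` can be solved for
  -- `X_y`.
  have hsec : ∀ p ∈ V,
      (fderiv ℝ X p (a p, b p) =
        (√(1 + α p ^ 2))⁻¹ • (α p • e2 X (fun _ => (1, 0)) p + reeb)) ↔
      fderiv ℝ X p (0, 1) = P p • (α p • e2 X (fun _ => (1, 0)) p + reeb)
        - Q p • fderiv ℝ X p (1, 0) := by
    intro p hp
    have hs : (√(1 + α p ^ 2))⁻¹ ≠ 0 := by positivity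
    have hP0 := (hP p hp).ne'
    have hab : ((a p, b p) : Plane) =
        (√(1 + α p ^ 2))⁻¹ • ((P p)⁻¹ • (Q p • ((1, 0) : Plane) + (0, 1))) := by
      rw [ha p hp, hb p hp]
      ext
      · change _ * (Q p / P p) = _ * ((P p)⁻¹ * (Q p * 1 + 0))
        ring
      · change _ * (1 / P p) = _ * ((P p)⁻¹ * (Q p * 0 + 1))
        ring
    rw [hab, map_smul, smul_right_injective H1 hs |>.eq_iff, map_smul, map_add, map_smul,
      inv_smul_eq_iff₀ hP0, eq_sub_iff_add_eq, add_comm]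
  constructor
  · rintro ⟨hdir, hcurv, hsecond⟩
    have hu : ∀ p ∈ V, pdx (fun s => (X s).1) p ^ 2 + pdx (fun s => (X s).2.1) p ^ 2 = 1 := by
      intro p hp
      have h0 := hdir.horizontal p hp
      rw [contactPlane, LinearMap.mem_ker] at h0
      have h1 := hdir.unit p hp
      rw [adaptedMetric, h0, e1, hcomp p hp] at h1
      simp only [pdx]
      linarith
    have hc : ∀ p ∈ V, pdx (pdx fun s => (X s).1) p = -(H p * pdx (fun s => (X s).2.1) p) ∧
        pdx (pdx fun s => (X s).2.1) p = H p * pdx (fun s => (X s).1) p := by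
      intro p hp
      have h1 := hcurv p hp
      rw [covDeriv_e2 hV hX hp, e1, hcomp p hp] at h1
      have h2 := congrArg Prod.fst h1
      have h3 := congrArg (fun q => q.2.1) h1
      simp [frame1, frame2] at h2 h3
      exact ⟨h3, h2⟩
    have hy : ∀ p ∈ V, fderiv ℝ X p (0, 1) = P p • (α p • e2 X (fun _ => (1, 0)) p + reeb)
        - Q p • fderiv ℝ X p (1, 0) := fun p hp => (hsec p hp).1 (hsecond p hp)
    have hz := fun p hp => (hhor p hp).1 (hdir.horizontal p hp)
    have hy1 : ∀ p ∈ V, pdy (fun s => (X s).1) p =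
        -(P p * α p * pdx (fun s => (X s).2.1) p) - Q p * pdx (fun s => (X s).1) p := by
      intro p hp
      have h1 := congrArg Prod.fst (hy p hp)
      simp [e2, e1, J, frame1, frame2, reeb, hcomp p hp] at h1
      simp only [pdx, pdy]
      linarith
    have hy2 : ∀ p ∈ V, pdy (fun s => (X s).2.1) p =
        P p * α p * pdx (fun s => (X s).1) p - Q p * pdx (fun s => (X s).2.1) p := by
      intro p hp
      have h1 := congrArg (fun q => q.2.1) (hy p hp)
      simp [e2, e1, J, frame1, frame2, reeb, hcomp p hp] at h1
      simp only [pdx, pdy]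
      linarith
    refine ⟨hu, hz, fun p hp => (hc p hp).1, fun p hp => (hc p hp).2, hy1, hy2, ?_⟩
    intro p hp
    have h1 := congrArg (fun q => q.2.2) (hy p hp)
    simp [e2, e1, J, frame1, frame2, reeb, hcomp p hp] at h1
    have h2 := hz p hp
    rw [hy1 p hp, hy2 p hp]
    simp only [pdx, pdy] at h2 ⊢
    rw [h2] at h1
    rw [h1]
    ring
  · intro hS
    refine ⟨⟨contDiffOn_const, fun p hp => (hhor p hp).2 (hS.pdx_z p hp), ?_⟩, ?_, ?_⟩
    · intro p hp
      have h0 := (hhor p hp).2 (hS.pdx_z p hp)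
      rw [contactPlane, LinearMap.mem_ker] at h0
      have h1 := hS.unit p hp
      rw [adaptedMetric, h0, e1, hcomp p hp]
      simp only [pdx] at h1
      linarith
    · intro p hp
      have h1 := hS.pdx_z p hp
      rw [covDeriv_e2 hV hX hp, hS.pdx_pdx_x p hp, hS.pdx_pdx_y p hp, e1, hcomp p hp]
      simp only [pdx] at h1 ⊢
      rw [h1]
      ext <;> simp [frame1, frame2]
      ring
    · intro p hp
      refine (hsec p hp).2 ?_
      have h1 := hS.pdx_z p hp
      have h2 := hS.pdy_x p hp
      have h3 := hS.pdy_y p hp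
      have h4 := hS.pdy_z p hp
      rw [h2, h3] at h4
      simp only [e2, e1, hcomp p hp]
      simp only [pdx, pdy] at h1 h2 h3 h4
      rw [h2, h3, h4, h1]
      ext <;> simp [J, frame1, frame2, reeb] <;> ring

/-- A solution of the frame system is an immersion without singular points. -/
theorem SolvesFrameSystem.injective_fderiv {X : Plane → H1} {V : Set Plane} (hV : IsOpen V)
    (hX : ContDiffOn ℝ ∞ X V) {α H P Q : Plane → ℝ} (hP : ∀ p ∈ V, 0 < P p)
    (hS : SolvesFrameSystem (fun s => (X s).1) (fun s => (X s).2.1) (fun s => (X s).2.2)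
      V α H P Q) {p : Plane} (hp : p ∈ V) : Function.Injective (fderiv ℝ X p) := by
  rw [injective_iff_map_eq_zero]
  intro v hv
  rw [fderiv_apply_components (differentiableAt_of_contDiffOn hV hX hp)] at hv
  simp only [fderiv_eq_pdx_pdy, Prod.mk_eq_zero] at hv
  obtain ⟨h1, h2, h3⟩ := hv
  rw [hS.pdx_z p hp, hS.pdy_z p hp] at h3
  -- This is `Θ` applied to `dX v = 0`, since `Θ(X_x) = 0` and `Θ(X_y) = P`.
  have hPv : v.2 * P p = 0 := by linear_combination h3 - (X p).2.1 * h1 + (X p).1 * h2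
  have hv2 : v.2 = 0 := (mul_eq_zero.1 hPv).resolve_right (hP p hp).ne'
  rw [hv2] at h1 h2
  have hv1 : v.1 = 0 := by
    linear_combination pdx (fun s => (X s).1) p * h1 + pdx (fun s => (X s).2.1) p * h2
      - v.1 * hS.unit p hp
  exact Prod.ext hv1 hv2

/-- The tangent vector `X_y` leaves the contact plane because `Θ(X_y) = P > 0`. -/
theorem SolvesFrameSystem.isRegularPoint {X : Plane → H1} {V : Set Plane} (hV : IsOpen V)
    (hX : ContDiffOn ℝ ∞ X V) {α H P Q : Plane → ℝ} (hP : ∀ p ∈ V, 0 < P p)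
    (hS : SolvesFrameSystem (fun s => (X s).1) (fun s => (X s).2.1) (fun s => (X s).2.2)
      V α H P Q) {p : Plane} (hp : p ∈ V) : IsRegularPoint X p := by
  intro heq
  have hmem : fderiv ℝ X p (0, 1) ∈ contactPlane (X p) := by
    rw [← heq]
    exact ⟨(0, 1), rfl⟩
  rw [contactPlane, LinearMap.mem_ker,
    fderiv_apply_components (differentiableAt_of_contDiffOn hV hX hp)] at hmem
  have h1 := hS.pdy_z p hp
  simp only [contactForm, LinearMap.coe_mk, AddHom.coe_mk] at hmem
  simp only [pdy] at h1
  exact (hP p hp).ne' (by linarith)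

/-- If `ê₂` is tangent to the surface, then so is `α e₂ + T`. -/
theorem IsSecondFrameField.isAlphaFunction {X : Plane → H1} {V : Set Plane} {u w : Plane → Plane}
    {α : Plane → ℝ} (h : IsSecondFrameField X V u α w) : IsAlphaFunction X V u α := by
  intro p hp
  have hs : √(1 + α p ^ 2) ≠ 0 := by positivity
  refine ⟨√(1 + α p ^ 2) • w p, ?_⟩
  change fderiv ℝ X p _ = _
  rw [map_smul, h p hp, smul_inv_smul₀ hs]

/-! ### Differentiation rules for the partial derivatives -/

section Rules

variable {f g : Plane → ℝ} {p : Plane}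

theorem pdx_const (c : ℝ) : pdx (fun _ => c) p = 0 := by simp [pdx]

theorem pdy_const (c : ℝ) : pdy (fun _ => c) p = 0 := by simp [pdy]

theorem pdx_neg : pdx (fun s => -f s) p = -pdx f p := by simp [pdx]

theorem pdx_add (hf : DifferentiableAt ℝ f p) (hg : DifferentiableAt ℝ g p) :
    pdx (fun s => f s + g s) p = pdx f p + pdx g p := by simp [pdx, fderiv_fun_add hf hg]

theorem pdy_add (hf : DifferentiableAt ℝ f p) (hg : DifferentiableAt ℝ g p) :
    pdy (fun s => f s + g s) p = pdy f p + pdy g p := by simp [pdy, fderiv_fun_add hf hg]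

theorem pdx_sub (hf : DifferentiableAt ℝ f p) (hg : DifferentiableAt ℝ g p) :
    pdx (fun s => f s - g s) p = pdx f p - pdx g p := by simp [pdx, fderiv_fun_sub hf hg]

theorem pdy_sub (hf : DifferentiableAt ℝ f p) (hg : DifferentiableAt ℝ g p) :
    pdy (fun s => f s - g s) p = pdy f p - pdy g p := by simp [pdy, fderiv_fun_sub hf hg]

theorem pdx_mul (hf : DifferentiableAt ℝ f p) (hg : DifferentiableAt ℝ g p) :
    pdx (fun s => f s * g s) p = pdx f p * g p + f p * pdx g p := by
  simp [pdx, fderiv_fun_mul hf hg]; ring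

theorem pdy_mul (hf : DifferentiableAt ℝ f p) (hg : DifferentiableAt ℝ g p) :
    pdy (fun s => f s * g s) p = pdy f p * g p + f p * pdy g p := by
  simp [pdy, fderiv_fun_mul hf hg]; ring

theorem pdx_cos (hf : DifferentiableAt ℝ f p) :
    pdx (fun s => Real.cos (f s)) p = -(Real.sin (f p) * pdx f p) := by
  simp [pdx, fderiv_cos hf]

theorem pdy_cos (hf : DifferentiableAt ℝ f p) :
    pdy (fun s => Real.cos (f s)) p = -(Real.sin (f p) * pdy f p) := by
  simp [pdy, fderiv_cos hf]

theorem pdx_sin (hf : DifferentiableAt ℝ f p) :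
    pdx (fun s => Real.sin (f s)) p = Real.cos (f p) * pdx f p := by
  simp [pdx, fderiv_sin hf]

theorem pdy_sin (hf : DifferentiableAt ℝ f p) :
    pdy (fun s => Real.sin (f s)) p = Real.cos (f p) * pdy f p := by
  simp [pdy, fderiv_sin hf]

theorem pdx_exp (hf : DifferentiableAt ℝ f p) :
    pdx (fun s => Real.exp (f s)) p = Real.exp (f p) * pdx f p := by
  simp [pdx, fderiv_exp hf]

theorem pdx_comp_snd {φ : ℝ → ℝ} (hφ : DifferentiableAt ℝ φ p.2) :
    pdx (fun s => φ s.2) p = 0 := by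
  have h : HasFDerivAt (fun s : Plane => φ s.2) _ p :=
    hφ.hasFDerivAt.comp p (hasFDerivAt_snd (𝕜 := ℝ) (p := p))
  simp [pdx, h.fderiv]

end Rules

/-! ### Integrability and local existence -/

/-- The assumptions on the coefficients of the frame system which make it integrable. -/
structure IsIntegrableData (V : Set Plane) (α H P Q : Plane → ℝ) : Prop where
  smooth_alpha : ContDiffOn ℝ ∞ α V
  smooth_curv : ContDiffOn ℝ ∞ H V
  smooth_P : ContDiffOn ℝ ∞ P V
  smooth_Q : ContDiffOn ℝ ∞ Q V
  pdx_P : ∀ p ∈ V, pdx P p = 2 * α p * P p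
  pdx_Q : ∀ p ∈ V, pdx Q p = -(H p * α p * P p)
  pdy_curv : ∀ p ∈ V, pdy H p = P p *
    (pdx (pdx α) p + 6 * α p * pdx α p + 4 * α p ^ 3 + α p * H p ^ 2) - Q p * pdx H p

theorem IsIntegrableData.mono {V W : Set Plane} {α H P Q : Plane → ℝ}
    (h : IsIntegrableData W α H P Q) (hVW : V ⊆ W) : IsIntegrableData V α H P Q :=
  ⟨h.smooth_alpha.mono hVW, h.smooth_curv.mono hVW, h.smooth_P.mono hVW, h.smooth_Q.mono hVW,
    fun p hp => h.pdx_P p (hVW hp), fun p hp => h.pdx_Q p (hVW hp),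
    fun p hp => h.pdy_curv p (hVW hp)⟩

/-- The derivative in the direction `∂/∂y` of the angle between `e₁` and the first left invariant
field. -/
noncomputable def angularSpeed (α H P Q : Plane → ℝ) (p : Plane) : ℝ :=
  P p * (pdx α p + 2 * α p * α p) - Q p * H p

/-- Local existence for the frame system. -/
theorem IsIntegrableData.exists_solution {V : Set Plane} (hV : IsOpen V) (hc : Convex ℝ V)
    {α H P Q : Plane → ℝ} (hD : IsIntegrableData V α H P Q) :
    ∃ x y z : Plane → ℝ, ContDiffOn ℝ ∞ x V ∧ ContDiffOn ℝ ∞ y V ∧ ContDiffOn ℝ ∞ z V ∧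
      SolvesFrameSystem x y z V α H P Q := by
  have sα := hD.smooth_alpha
  have sH := hD.smooth_curv
  have sP := hD.smooth_P
  have sQ := hD.smooth_Q
  have sα' := contDiffOn_pdx hV sα
  have dα := fun p (hp : p ∈ V) => differentiableAt_of_contDiffOn hV sα hp
  have dα' := fun p (hp : p ∈ V) => differentiableAt_of_contDiffOn hV sα' hp
  have dH := fun p (hp : p ∈ V) => differentiableAt_of_contDiffOn hV sH hp
  have dP := fun p (hp : p ∈ V) => differentiableAt_of_contDiffOn hV sP hp
  have dQ := fun p (hp : p ∈ V) => differentiableAt_of_contDiffOn hV sQ hp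
  have hw : ContDiffOn ℝ ∞ (angularSpeed α H P Q) V :=
    (sP.mul (sα'.add ((contDiffOn_const.mul sα).mul sα))).sub (sQ.mul sH)
  -- `θ` is the angle of `e₁`; after substituting `P_x` and `Q_x`, closedness of its differential is
  -- the equation `pdy_curv`.
  obtain ⟨θ, sθ, θx, θy⟩ := exists_potential hV hc sH hw fun p hp => by
    have := dα p hp
    have := dα' p hp
    have := dH p hp
    have := dP p hp
    have := dQ p hp
    rw [hD.pdy_curv p hp]
    change _ = pdx (fun s => P s * (pdx α s + 2 * α s * α s) - Q s * H s) p
    simp (disch := fun_prop) only [pdx_sub, pdx_mul, pdx_add, pdx_const,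
      hD.pdx_P p hp, hD.pdx_Q p hp]
    ring
  have dθ := fun p (hp : p ∈ V) => differentiableAt_of_contDiffOn hV sθ hp
  have sc : ContDiffOn ℝ ∞ (fun p => Real.cos (θ p)) V := sθ.cos
  have ss : ContDiffOn ℝ ∞ (fun p => Real.sin (θ p)) V := sθ.sin
  -- In the closedness check the `cos θ` terms cancel by `Q_x = -HαP`; the `sin θ` terms match by
  -- `P_x = 2αP` and the choice of `θ_y`.
  obtain ⟨x, sx, xx, xy⟩ := exists_potential (F := fun p => Real.cos (θ p))
    (G := fun p => -(P p * α p * Real.sin (θ p)) - Q p * Real.cos (θ p)) hV hc sc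
    (((sP.mul sα).mul ss).neg.sub (sQ.mul sc)) fun p hp => by
      have := dα p hp
      have := dP p hp
      have := dQ p hp
      have := dθ p hp
      simp (disch := fun_prop) only [pdx_sub, pdx_mul, pdx_neg, pdx_cos, pdx_sin, pdy_cos,
        hD.pdx_P p hp, hD.pdx_Q p hp, θx p hp, θy p hp, angularSpeed]
      ring
  obtain ⟨y, sy, yx, yy⟩ := exists_potential (F := fun p => Real.sin (θ p))
    (G := fun p => P p * α p * Real.cos (θ p) - Q p * Real.sin (θ p)) hV hc ss
    (((sP.mul sα).mul sc).sub (sQ.mul ss)) fun p hp => by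
      have := dα p hp
      have := dP p hp
      have := dQ p hp
      have := dθ p hp
      simp (disch := fun_prop) only [pdx_sub, pdx_mul, pdx_cos, pdx_sin, pdy_sin,
        hD.pdx_P p hp, hD.pdx_Q p hp, θx p hp, θy p hp, angularSpeed]
      ring
  have sx' := contDiffOn_pdx hV sx
  have sx'' := contDiffOn_pdy hV sx
  have sy' := contDiffOn_pdx hV sy
  have sy'' := contDiffOn_pdy hV sy
  -- The equations `Θ(X_x) = 0` and `Θ(X_y) = P` prescribe `dz`. Closedness reads `P_x = 2 (x_x y_y
  -- - x_y y_x)`, and the right side is `2αP (cos² θ + sin² θ)`.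
  obtain ⟨z, sz, zx, zy⟩ := exists_potential (F := fun p => y p * pdx x p - x p * pdx y p)
    (G := fun p => y p * pdy x p - x p * pdy y p + P p) hV hc
    ((sy.mul sx').sub (sx.mul sy')) (((sy.mul sx'').sub (sx.mul sy'')).add sP) fun p hp => by
      have := dP p hp
      have := differentiableAt_of_contDiffOn hV sx hp
      have := differentiableAt_of_contDiffOn hV sy hp
      have := differentiableAt_of_contDiffOn hV sx' hp
      have := differentiableAt_of_contDiffOn hV sy' hp
      have := differentiableAt_of_contDiffOn hV sx'' hp
      have := differentiableAt_of_contDiffOn hV sy'' hp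
      simp (disch := fun_prop) only [pdx_sub, pdx_mul, pdx_add, pdy_sub, pdy_mul,
        pdx_pdy_comm hV sx hp, pdx_pdy_comm hV sy hp, hD.pdx_P p hp, xx p hp, xy p hp,
        yx p hp, yy p hp]
      linear_combination (2 * α p * P p) * Real.sin_sq_add_cos_sq (θ p)
  refine ⟨x, y, z, sx, sy, sz, ?_, zx, ?_, ?_, ?_, ?_, zy⟩
  · intro p hp
    rw [xx p hp, yx p hp, Real.cos_sq_add_sin_sq]
  · intro p hp
    rw [pdx_congr hV xx hp, pdx_cos (dθ p hp), θx p hp, yx p hp, mul_comm]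
  · intro p hp
    rw [pdx_congr hV yx hp, pdx_sin (dθ p hp), θx p hp, xx p hp, mul_comm]
  · intro p hp
    rw [xy p hp, xx p hp, yx p hp]
  · intro p hp
    rw [yy p hp, xx p hp, yx p hp]

/-! ### Uniqueness up to rotation and translation -/

/-- The second mixed derivatives of a solution of the frame system. -/
theorem SolvesFrameSystem.pdy_pdx {V : Set Plane} (hV : IsOpen V) {α H P Q : Plane → ℝ}
    (hD : IsIntegrableData V α H P Q) {x y z : Plane → ℝ} (sx : ContDiffOn ℝ ∞ x V)
    (sy : ContDiffOn ℝ ∞ y V) (hS : SolvesFrameSystem x y z V α H P Q) {p : Plane} (hp : p ∈ V) :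
    pdy (pdx x) p = -(angularSpeed α H P Q p * pdx y p) ∧
      pdy (pdx y) p = angularSpeed α H P Q p * pdx x p := by
  have := differentiableAt_of_contDiffOn hV hD.smooth_alpha hp
  have := differentiableAt_of_contDiffOn hV hD.smooth_P hp
  have := differentiableAt_of_contDiffOn hV hD.smooth_Q hp
  have := differentiableAt_of_contDiffOn hV (contDiffOn_pdx hV sx) hp
  have := differentiableAt_of_contDiffOn hV (contDiffOn_pdx hV sy) hp
  -- Exchanging the derivatives leaves only `x`-derivatives of the equations for `x_y` and `y_y`,
  -- all of which the system and the data supply.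
  rw [← pdx_pdy_comm hV sx hp, ← pdx_pdy_comm hV sy hp, pdx_congr hV hS.pdy_x hp,
    pdx_congr hV hS.pdy_y hp]
  constructor <;>
  · simp (disch := fun_prop) only [pdx_sub, pdx_mul, pdx_neg, hD.pdx_P p hp, hD.pdx_Q p hp,
      hS.pdx_pdx_x p hp, hS.pdx_pdx_y p hp, angularSpeed]
    ring

/-- Two solutions of the frame system on a connected set differ by a rotation about the vertical
axis followed by a left translation. -/
theorem SolvesFrameSystem.exists_rigid {V : Set Plane} (hV : IsOpen V) (hc : IsConnected V)
    {α H P Q : Plane → ℝ} (hD : IsIntegrableData V α H P Q) {x y z x' y' z' : Plane → ℝ}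
    (sx : ContDiffOn ℝ ∞ x V) (sy : ContDiffOn ℝ ∞ y V) (sz : ContDiffOn ℝ ∞ z V)
    (sx' : ContDiffOn ℝ ∞ x' V) (sy' : ContDiffOn ℝ ∞ y' V) (sz' : ContDiffOn ℝ ∞ z' V)
    (hS : SolvesFrameSystem x y z V α H P Q) (hS' : SolvesFrameSystem x' y' z' V α H P Q) :
    ∃ m n c₁ c₂ c₃ : ℝ, m ^ 2 + n ^ 2 = 1 ∧ ∀ p ∈ V, x' p = m * x p - n * y p + c₁ ∧
      y' p = n * x p + m * y p + c₂ ∧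
      z' p = z p - c₁ * (n * x p + m * y p) + c₂ * (m * x p - n * y p) + c₃ := by
  have su := contDiffOn_pdx hV sx
  have sv := contDiffOn_pdx hV sy
  have su' := contDiffOn_pdx hV sx'
  have sv' := contDiffOn_pdx hV sy'
  have dx := fun p (hp : p ∈ V) => differentiableAt_of_contDiffOn hV sx hp
  have dy := fun p (hp : p ∈ V) => differentiableAt_of_contDiffOn hV sy hp
  have dz := fun p (hp : p ∈ V) => differentiableAt_of_contDiffOn hV sz hp
  have dx' := fun p (hp : p ∈ V) => differentiableAt_of_contDiffOn hV sx' hp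
  have dy' := fun p (hp : p ∈ V) => differentiableAt_of_contDiffOn hV sy' hp
  have dz' := fun p (hp : p ∈ V) => differentiableAt_of_contDiffOn hV sz' hp
  have du := fun p (hp : p ∈ V) => differentiableAt_of_contDiffOn hV su hp
  have dv := fun p (hp : p ∈ V) => differentiableAt_of_contDiffOn hV sv hp
  have du' := fun p (hp : p ∈ V) => differentiableAt_of_contDiffOn hV su' hp
  have dv' := fun p (hp : p ∈ V) => differentiableAt_of_contDiffOn hV sv' hp
  -- `m` and `n` are the cosine and sine of the angle between the two fields `e₁`. They are constant
  -- because both fields turn at rate `H` in `x` and at rate `angularSpeed` in `y`.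
  obtain ⟨m, hm⟩ := exists_eq_const_of_pd_eq_zero hV hc.isPreconnected
    (f := fun p => pdx x p * pdx x' p + pdx y p * pdx y' p) ((su.mul su').add (sv.mul sv'))
    (fun p hp => by
      have := du p hp
      have := dv p hp
      have := du' p hp
      have := dv' p hp
      simp (disch := fun_prop) only [pdx_add, pdx_mul, hS.pdx_pdx_x p hp, hS.pdx_pdx_y p hp,
        hS'.pdx_pdx_x p hp, hS'.pdx_pdx_y p hp]
      ring)
    (fun p hp => by
      have := du p hp
      have := dv p hp
      have := du' p hp
      have := dv' p hp
      simp (disch := fun_prop) only [pdy_add, pdy_mul, (hS.pdy_pdx hV hD sx sy hp).1,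
        (hS.pdy_pdx hV hD sx sy hp).2, (hS'.pdy_pdx hV hD sx' sy' hp).1,
        (hS'.pdy_pdx hV hD sx' sy' hp).2]
      ring)
  obtain ⟨n, hn⟩ := exists_eq_const_of_pd_eq_zero hV hc.isPreconnected
    (f := fun p => pdx x p * pdx y' p - pdx y p * pdx x' p) ((su.mul sv').sub (sv.mul su'))
    (fun p hp => by
      have := du p hp
      have := dv p hp
      have := du' p hp
      have := dv' p hp
      simp (disch := fun_prop) only [pdx_sub, pdx_mul, hS.pdx_pdx_x p hp, hS.pdx_pdx_y p hp,
        hS'.pdx_pdx_x p hp, hS'.pdx_pdx_y p hp]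
      ring)
    (fun p hp => by
      have := du p hp
      have := dv p hp
      have := du' p hp
      have := dv' p hp
      simp (disch := fun_prop) only [pdy_sub, pdy_mul, (hS.pdy_pdx hV hD sx sy hp).1,
        (hS.pdy_pdx hV hD sx sy hp).2, (hS'.pdy_pdx hV hD sx' sy' hp).1,
        (hS'.pdy_pdx hV hD sx' sy' hp).2]
      ring)
  have hmn : m ^ 2 + n ^ 2 = 1 := by
    obtain ⟨p, hp⟩ := hc.nonempty
    rw [← hm p hp, ← hn p hp]
    linear_combination (pdx x' p ^ 2 + pdx y' p ^ 2) * hS.unit p hp + hS'.unit p hp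
  have hu' : ∀ p ∈ V, pdx x' p = m * pdx x p - n * pdx y p := by
    intro p hp
    rw [← hm p hp, ← hn p hp]
    linear_combination -(pdx x' p) * hS.unit p hp
  have hv' : ∀ p ∈ V, pdx y' p = n * pdx x p + m * pdx y p := by
    intro p hp
    rw [← hm p hp, ← hn p hp]
    linear_combination -(pdx y' p) * hS.unit p hp
  have hxy : ∀ p ∈ V, pdy x' p = m * pdy x p - n * pdy y p := by
    intro p hp
    rw [hS'.pdy_x p hp, hS.pdy_x p hp, hS.pdy_y p hp, hu' p hp, hv' p hp]
    ring
  have hyy : ∀ p ∈ V, pdy y' p = n * pdy x p + m * pdy y p := by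
    intro p hp
    rw [hS'.pdy_y p hp, hS.pdy_x p hp, hS.pdy_y p hp, hu' p hp, hv' p hp]
    ring
  obtain ⟨c₁, hc₁⟩ := exists_eq_const_of_pd_eq_zero hV hc.isPreconnected
    (f := fun p => x' p - (m * x p - n * y p))
    (sx'.sub ((contDiffOn_const.mul sx).sub (contDiffOn_const.mul sy)))
    (fun p hp => by
      have := dx p hp
      have := dy p hp
      have := dx' p hp
      simp (disch := fun_prop) only [pdx_sub, pdx_mul, pdx_const, hu' p hp]
      ring)
    (fun p hp => by
      have := dx p hp
      have := dy p hp
      have := dx' p hp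
      simp (disch := fun_prop) only [pdy_sub, pdy_mul, pdy_const, hxy p hp]
      ring)
  obtain ⟨c₂, hc₂⟩ := exists_eq_const_of_pd_eq_zero hV hc.isPreconnected
    (f := fun p => y' p - (n * x p + m * y p))
    (sy'.sub ((contDiffOn_const.mul sx).add (contDiffOn_const.mul sy)))
    (fun p hp => by
      have := dx p hp
      have := dy p hp
      have := dy' p hp
      simp (disch := fun_prop) only [pdx_sub, pdx_add, pdx_mul, pdx_const, hv' p hp]
      ring)
    (fun p hp => by
      have := dx p hp
      have := dy p hp
      have := dy' p hp
      simp (disch := fun_prop) only [pdy_sub, pdy_add, pdy_mul, pdy_const, hyy p hp]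
      ring)
  have hx'eq : ∀ p ∈ V, x' p = m * x p - n * y p + c₁ := fun p hp => by linarith [hc₁ p hp]
  have hy'eq : ∀ p ∈ V, y' p = n * x p + m * y p + c₂ := fun p hp => by linarith [hc₂ p hp]
  -- The subtracted expression is, up to a constant, the third coordinate of the rotated point after
  -- left translation. The derivatives agree because the rotation preserves `y dx - x dy`, whence
  -- the factor `hmn`.
  obtain ⟨c₃, hc₃⟩ := exists_eq_const_of_pd_eq_zero hV hc.isPreconnected
    (f := fun p => z' p - (z p - c₁ * (n * x p + m * y p) + c₂ * (m * x p - n * y p)))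
    (sz'.sub ((sz.sub (contDiffOn_const.mul ((contDiffOn_const.mul sx).add
      (contDiffOn_const.mul sy)))).add (contDiffOn_const.mul ((contDiffOn_const.mul sx).sub
      (contDiffOn_const.mul sy)))))
    (fun p hp => by
      have := dx p hp
      have := dy p hp
      have := dz p hp
      have := dz' p hp
      simp (disch := fun_prop) only [pdx_sub, pdx_add, pdx_mul, pdx_const, hS'.pdx_z p hp,
        hS.pdx_z p hp, hu' p hp, hv' p hp, hx'eq p hp, hy'eq p hp]
      linear_combination (y p * pdx x p - x p * pdx y p) * hmn)
    (fun p hp => by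
      have := dx p hp
      have := dy p hp
      have := dz p hp
      have := dz' p hp
      simp (disch := fun_prop) only [pdy_sub, pdy_add, pdy_mul, pdy_const, hS'.pdy_z p hp,
        hS.pdy_z p hp, hxy p hp, hyy p hp, hx'eq p hp, hy'eq p hp]
      linear_combination (y p * pdy x p - x p * pdy y p) * hmn)
  exact ⟨m, n, c₁, c₂, c₃, hmn, fun p hp =>
    ⟨hx'eq p hp, hy'eq p hp, by linarith [hc₃ p hp]⟩⟩

/-! ### Rotations and left translations as rigid motions -/

/-- The linear part of a Heisenberg rigid motion. -/
def rigidLinear (m n c₁ c₂ : ℝ) : H1 →ₗ[ℝ] H1 where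
  toFun q := (m * q.1 - n * q.2.1, n * q.1 + m * q.2.1,
    q.2.2 - c₁ * (n * q.1 + m * q.2.1) + c₂ * (m * q.1 - n * q.2.1))
  map_add' q r := by ext <;> simp <;> ring
  map_smul' c q := by ext <;> simp <;> ring

/-- The rotation `(m, n)` about the vertical axis followed by the left translation by
`(c₁, c₂, c₃)`. -/
noncomputable def rigidMotion (m n c₁ c₂ c₃ : ℝ) (hmn : m ^ 2 + n ^ 2 = 1) :
    H1 ≃ₘ^∞⟮𝓘(ℝ, H1), 𝓘(ℝ, H1)⟯ H1 where
  toFun q := rigidLinear m n c₁ c₂ q + (c₁, c₂, c₃)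
  invFun q := (m * (q.1 - c₁) + n * (q.2.1 - c₂), -(n * (q.1 - c₁)) + m * (q.2.1 - c₂),
    q.2.2 + c₁ * (q.2.1 - c₂) - c₂ * (q.1 - c₁) - c₃)
  left_inv q := by
    ext
    · simp [rigidLinear]
      linear_combination q.1 * hmn
    · simp [rigidLinear]
      linear_combination q.2.1 * hmn
    · simp [rigidLinear]
      ring
  right_inv q := by
    ext
    · simp [rigidLinear]
      linear_combination (q.1 - c₁) * hmn
    · simp [rigidLinear]
      linear_combination (q.2.1 - c₂) * hmn
    · simp [rigidLinear]
      linear_combination (-c₁ * (q.2.1 - c₂) + c₂ * (q.1 - c₁)) * hmn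
  contMDiff_toFun := by
    rw [contMDiff_iff_contDiff]
    exact (LinearMap.toContinuousLinearMap (rigidLinear m n c₁ c₂)).contDiff.add contDiff_const
  contMDiff_invFun := by
    rw [contMDiff_iff_contDiff]
    simp only [Equiv.coe_fn_symm_mk]
    fun_prop

theorem rigidMotion_apply (m n c₁ c₂ c₃ : ℝ) (hmn : m ^ 2 + n ^ 2 = 1) (q : H1) :
    rigidMotion m n c₁ c₂ c₃ hmn q = rigidLinear m n c₁ c₂ q + (c₁, c₂, c₃) := rfl

theorem fderiv_rigidMotion (m n c₁ c₂ c₃ : ℝ) (hmn : m ^ 2 + n ^ 2 = 1) (q v : H1) :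
    fderiv ℝ (rigidMotion m n c₁ c₂ c₃ hmn) q v = rigidLinear m n c₁ c₂ v := by
  have h : HasFDerivAt (rigidMotion m n c₁ c₂ c₃ hmn)
      (LinearMap.toContinuousLinearMap (rigidLinear m n c₁ c₂)) q :=
    (LinearMap.toContinuousLinearMap (rigidLinear m n c₁ c₂)).hasFDerivAt.add_const (c₁, c₂, c₃)
  rw [h.fderiv]
  rfl

theorem isRigidMotion_rigidMotion (m n c₁ c₂ c₃ : ℝ) (hmn : m ^ 2 + n ^ 2 = 1) :
    IsRigidMotion (rigidMotion m n c₁ c₂ c₃ hmn) where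
  contact q v := by
    rw [fderiv_rigidMotion, rigidMotion_apply]
    simp [contactForm, rigidLinear]
    -- The translation terms cancel; `x dy - y dx` is scaled by the determinant `m² + n² = 1`.
    linear_combination (q.1 * v.2.1 - q.2.1 * v.1) * hmn
  cr q v _ := by
    rw [fderiv_rigidMotion, fderiv_rigidMotion, rigidMotion_apply]
    ext
    · simp [J, frame1, frame2, rigidLinear]
      ring
    · simp [J, frame1, frame2, rigidLinear]
      ring
    · simp [J, frame1, frame2, rigidLinear]
      linear_combination (v.1 * q.1 + v.2.1 * q.2.1) * hmn

/-! ### The data determined by `A`, `B`, `h` and `k` -/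

section Coefficients

variable {U : Set Plane} {α H A B : Plane → ℝ} {h k : ℝ → ℝ}

/-- The functions supplied for `P` and `Q` are `1 / (b √(1 + α²))` and `a / b`. Factors depending on
`y` alone do not affect the `x`-derivatives, and the last condition is the integrability condition
multiplied by `e^{-k}`. -/
theorem isIntegrableData_of_integrabilityCondition (hU : IsOpen U)
    (hα : ContDiffOn ℝ ∞ α U) (hH : ContDiffOn ℝ ∞ H U)
    (hA : IsXAntiderivative A (fun p => 2 * α p) U)
    (hB : IsXAntiderivative B (fun p => H p * α p * Real.exp (A p)) U)
    (hh : ContDiffOn ℝ ∞ h (Prod.snd '' U)) (hk : ContDiffOn ℝ ∞ k (Prod.snd '' U))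
    (hint : IntegrabilityCondition U α H A B h k) :
    IsIntegrableData U α H (fun p => Real.exp (A p - k p.2))
      (fun p => Real.exp (-k p.2) * (h p.2 - B p)) := by
  have sh : ContDiffOn ℝ ∞ (fun p : Plane => h p.2) U :=
    hh.comp contDiffOn_snd fun p hp => Set.mem_image_of_mem _ hp
  have sk : ContDiffOn ℝ ∞ (fun p : Plane => k p.2) U :=
    hk.comp contDiffOn_snd fun p hp => Set.mem_image_of_mem _ hp
  have hsnd : IsOpen (Prod.snd '' U) := isOpenMap_snd U hU
  have dh : ∀ p ∈ U, DifferentiableAt ℝ h p.2 := fun p hp =>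
    (hh.contDiffAt (hsnd.mem_nhds (Set.mem_image_of_mem _ hp))).differentiableAt (by simp)
  have dk : ∀ p ∈ U, DifferentiableAt ℝ k p.2 := fun p hp =>
    (hk.contDiffAt (hsnd.mem_nhds (Set.mem_image_of_mem _ hp))).differentiableAt (by simp)
  refine ⟨hα, hH, (hA.1.sub sk).exp, sk.neg.exp.mul (sh.sub hB.1), ?_, ?_, ?_⟩
  · intro p hp
    have := differentiableAt_of_contDiffOn hU hA.1 hp
    have := differentiableAt_of_contDiffOn hU sk hp
    simp (disch := first | fun_prop | exact dk p hp) only [pdx_exp, pdx_sub, pdx_comp_snd,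
      hA.2 p hp]
    ring
  · intro p hp
    have := differentiableAt_of_contDiffOn hU hB.1 hp
    have := differentiableAt_of_contDiffOn hU sh hp
    have := differentiableAt_of_contDiffOn hU sk hp
    simp (disch := first | fun_prop | exact dk p hp | exact dh p hp) only [pdx_exp, pdx_sub,
      pdx_mul, pdx_neg, pdx_comp_snd, hB.2 p hp]
    rw [sub_eq_add_neg (A p), Real.exp_add]
    ring
  · intro p hp
    have h1 := hint p hp
    have hE : Real.exp (-k p.2) * Real.exp (k p.2) = 1 := by rw [← Real.exp_add]; simp
    have hE' : Real.exp (A p - k p.2) = Real.exp (-k p.2) * Real.exp (A p) := by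
      rw [← Real.exp_add]; ring_nf
    simp only [hE']
    linear_combination Real.exp (-k p.2) * h1 - pdy H p * hE

theorem coeffA_eq (p : Plane) : coeffA α A B h p = (√(1 + α p ^ 2))⁻¹ *
    ((Real.exp (-k p.2) * (h p.2 - B p)) / Real.exp (A p - k p.2)) := by
  have hE : Real.exp (A p - k p.2) = Real.exp (-k p.2) * Real.exp (A p) := by
    rw [← Real.exp_add]; ring_nf
  rw [coeffA, hE, mul_div_mul_left _ _ (Real.exp_ne_zero _), Real.exp_neg]
  ring

theorem coeffB_eq (p : Plane) : coeffB α A k p = (√(1 + α p ^ 2))⁻¹ *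
    (1 / Real.exp (A p - k p.2)) := by
  rw [coeffB, one_div, ← Real.exp_neg, neg_sub, sub_eq_add_neg, Real.exp_add]
  ring

end Coefficients

/-! ### Existence and uniqueness of the surface -/

/-- Local existence of a surface with prescribed data. -/
theorem IsIntegrableData.exists_isRealization {U : Set Plane} (hU : IsOpen U)
    {α H P Q a b : Plane → ℝ} (hD : IsIntegrableData U α H P Q) (hP : ∀ p ∈ U, 0 < P p)
    (ha : ∀ p ∈ U, a p = (√(1 + α p ^ 2))⁻¹ * (Q p / P p))
    (hb : ∀ p ∈ U, b p = (√(1 + α p ^ 2))⁻¹ * (1 / P p)) {p : Plane} (hp : p ∈ U) :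
    ∃ V : Set Plane, IsOpen V ∧ IsConnected V ∧ p ∈ V ∧ V ⊆ U ∧
      ∃ X : Plane → H1, IsRealization X V α H a b := by
  obtain ⟨r, hr, hrU⟩ := Metric.isOpen_iff.1 hU p hp
  obtain ⟨x, y, z, sx, sy, sz, hS⟩ :=
    (hD.mono hrU).exists_solution Metric.isOpen_ball (convex_ball p r)
  let X : Plane → H1 := fun s => (x s, y s, z s)
  have sX : ContDiffOn ℝ ∞ X (Metric.ball p r) := sx.prodMk (sy.prodMk sz)
  have hinj := fun q (hq : q ∈ Metric.ball p r) =>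
    SolvesFrameSystem.injective_fderiv (X := X) Metric.isOpen_ball sX
      (fun s hs => hP s (hrU hs)) hS hq
  have hpr := Metric.mem_ball_self (x := p) hr
  obtain ⟨s, hs, hemb⟩ := exists_isEmbedding_of_injective_fderiv
    ((sX.contDiffAt (Metric.isOpen_ball.mem_nhds hpr)).hasStrictFDerivAt (by simp)) (hinj p hpr)
  -- The system is solved on the ball of radius `r`, where `X` is an immersion; a smaller ball makes
  -- it an embedding.
  obtain ⟨r', hr', hr's⟩ := Metric.mem_nhds_iff.1
    (Filter.inter_mem hs (Metric.isOpen_ball.mem_nhds hpr))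
  have hsub : Metric.ball p r' ⊆ Metric.ball p r := hr's.trans Set.inter_subset_right
  have hsubU := hsub.trans hrU
  have sX' := sX.mono hsub
  have hgeo := (solvesFrameSystem_iff Metric.isOpen_ball sX (fun q hq => hP q (hrU hq))
    (fun q hq => ha q (hrU hq)) (fun q hq => hb q (hrU hq))).2 hS
  obtain ⟨hdir, hcurv, hsec⟩ := hgeo
  refine ⟨Metric.ball p r', Metric.isOpen_ball, (convex_ball p r').isConnected
    ⟨p, Metric.mem_ball_self hr'⟩, Metric.mem_ball_self hr', hsubU, X, ?_⟩
  refine ⟨⟨sX', fun q hq => hinj q (hsub hq), ?_⟩, fun q hq => ?_,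
    ⟨contDiffOn_const, fun q hq => hdir.horizontal q (hsub hq),
      fun q hq => hdir.unit q (hsub hq)⟩, fun q hq => hcurv q (hsub hq),
    fun q hq => hsec.isAlphaFunction q (hsub hq), fun q hq => hsec q (hsub hq)⟩
  · exact hemb.comp (Topology.IsEmbedding.inclusion (hr's.trans Set.inter_subset_left))
  · exact SolvesFrameSystem.isRegularPoint (X := X) Metric.isOpen_ball sX
      (fun s hs => hP s (hrU hs)) hS (hsub hq)

/-- Uniqueness, up to a rigid motion, of a connected surface with prescribed data. -/
theorem IsRealization.exists_isRigidMotion {V : Set Plane} (hV : IsOpen V) (hc : IsConnected V)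
    {α H P Q a b : Plane → ℝ} (hD : IsIntegrableData V α H P Q) (hP : ∀ p ∈ V, 0 < P p)
    (ha : ∀ p ∈ V, a p = (√(1 + α p ^ 2))⁻¹ * (Q p / P p))
    (hb : ∀ p ∈ V, b p = (√(1 + α p ^ 2))⁻¹ * (1 / P p)) {X Y : Plane → H1}
    (hX : IsRealization X V α H a b) (hY : IsRealization Y V α H a b) :
    ∃ Φ : H1 ≃ₘ^∞⟮𝓘(ℝ, H1), 𝓘(ℝ, H1)⟯ H1, IsRigidMotion Φ ∧ ∀ p ∈ V, Y p = Φ (X p) := by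
  have sX := hX.embedding.smooth
  have sY := hY.embedding.smooth
  obtain ⟨m, n, c₁, c₂, c₃, hmn, heq⟩ := SolvesFrameSystem.exists_rigid hV hc hD
    sX.fst sX.snd.fst sX.snd.snd sY.fst sY.snd.fst sY.snd.snd
    ((solvesFrameSystem_iff hV sX hP ha hb).1 ⟨hX.direction, hX.curvature, hX.second⟩)
    ((solvesFrameSystem_iff hV sY hP ha hb).1 ⟨hY.direction, hY.curvature, hY.second⟩)
  refine ⟨rigidMotion m n c₁ c₂ c₃ hmn, isRigidMotion_rigidMotion m n c₁ c₂ c₃ hmn, ?_⟩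
  intro p hp
  obtain ⟨h1, h2, h3⟩ := heq p hp
  exact Prod.ext h1 (Prod.ext h2 h3)

end Heisenberg

theorem theorem1p2 (U : Set Heisenberg.Plane) (hU : IsOpen U)
    (α H : Heisenberg.Plane → ℝ) (hα : ContDiffOn ℝ ∞ α U) (hH : ContDiffOn ℝ ∞ H U)
    (A B : Heisenberg.Plane → ℝ)
    (hA : Heisenberg.IsXAntiderivative A (fun p => 2 * α p) U)
    (hB : Heisenberg.IsXAntiderivative B (fun p => H p * α p * Real.exp (A p)) U)
    (h k : ℝ → ℝ) (hh : ContDiffOn ℝ ∞ h (Prod.snd '' U)) (hk : ContDiffOn ℝ ∞ k (Prod.snd '' U))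
    (hint : Heisenberg.IntegrabilityCondition U α H A B h k) :
    (∀ p ∈ U, ∃ V : Set Heisenberg.Plane, IsOpen V ∧ IsConnected V ∧ p ∈ V ∧ V ⊆ U ∧
      ∃ X : Heisenberg.Plane → Heisenberg.H1,
        Heisenberg.IsRealization X V α H
          (Heisenberg.coeffA α A B h) (Heisenberg.coeffB α A k)) ∧
    (∀ V : Set Heisenberg.Plane, IsOpen V → IsConnected V → V ⊆ U →
      ∀ X Y : Heisenberg.Plane → Heisenberg.H1,
        Heisenberg.IsRealization X V α H
          (Heisenberg.coeffA α A B h) (Heisenberg.coeffB α A k) →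
        Heisenberg.IsRealization Y V α H
          (Heisenberg.coeffA α A B h) (Heisenberg.coeffB α A k) →
        ∃ Φ : Heisenberg.H1 ≃ₘ^∞⟮𝓘(ℝ, Heisenberg.H1), 𝓘(ℝ, Heisenberg.H1)⟯ Heisenberg.H1,
          Heisenberg.IsRigidMotion Φ ∧ ∀ p ∈ V, Y p = Φ (X p)) := by
  have hD := Heisenberg.isIntegrableData_of_integrabilityCondition hU hα hH hA hB hh hk hint
  constructor
  · intro p hp
    exact hD.exists_isRealization hU (fun q _ => Real.exp_pos _)
      (fun q _ => Heisenberg.coeffA_eq q) (fun q _ => Heisenberg.coeffB_eq q) hp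
  · intro V hV hc hVU X Y hX hY
    exact hX.exists_isRigidMotion hV hc (hD.mono hVU) (fun q _ => Real.exp_pos _)
      (fun q _ => Heisenberg.coeffA_eq q) (fun q _ => Heisenberg.coeffB_eq q) hY
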